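/- Let $k$ be an algebraically closed field of characteristic zero, let $r\ge 0$, and equip $R=k[x_0,\dots,x_r]$ and $\bar R=k[x_1,\dots,x_r]$ with the standard grading and with the graded lexicographic order, $x_0>x_1>\dots>x_r$. For a homogeneous ideal $J$ of $k[x_s,\dots,x_r]$ ($s=0$ or $1$), let $\operatorname{in}(J)$ be its initial ideal, and let $\operatorname{Gin}(J)$ be its generic initial ideal, i.e. the constant value of $\operatorname{in}(g(J))$ for $g$ in a nonempty Zariski open subset of the group $\mathrm{GL}_{r+1-s}(k)$ of linear changes of the variables. One says that $J$ is in generic coordinates if $\operatorname{in}(J)=\operatorname{Gin}(J)$. Let $M(J)$ be the maximum of the degrees of the minimal monomial generators of $\operatorname{Gin}(J)$, with $M(0)=-\infty$. For a homogeneous ideal $I\subset R$, a homogeneous $f\in I$, $f\ne 0$, let $d_0(f)$ be the exponent of $x_0$ in the leading monomial of $f$, and for $i\ge 0$ put $$\widetilde K_i(I)=\bigoplus_{d\ge 0}\{f\in I_d \mid f=0\text{ or } d_0(f)\le i\}.$$ Every $f\in\widetilde K_i(I)$ can be written uniquely as $f=x_0^i\bar f+g$ with $\bar f\in\bar R$ and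 every monomial of $g$ having $x_0$-exponent less than $i$. The $i$-th partial elimination ideal $K_i(I)\subset\bar R$ is the image of $\widetilde K_i(I)$ under $f\mapsto\bar f$. Let $I\subset R$ be a nonzero homogeneous ideal in generic coordinates, and let $\beta=\min\{j\mid I_j\ne 0\}$. Then $$M(I)=\max\{\,M(K_i(I))+i \mid 0\le i\le\beta\,\}.$$ -/

import Mathlib

open MvPolynomial

noncomputable section

namespace PartialElim

variable {k : Type*} [Field k]

attribute [local instance] MvPolynomial.gradedAlgebra

/-- `I` is a homogeneous ideal for the standard grading of the polynomial ring. -/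
def IsHomogeneousIdeal {n : ℕ} (I : Ideal (MvPolynomial (Fin n) k)) : Prop :=
  I.IsHomogeneous (homogeneousSubmodule (Fin n) k)

/-! ### Initial ideals, linear changes of coordinates, generic initial ideals

`MvPolynomial (Fin n) k` is the polynomial ring in the variables `X 0, …, X (n - 1)`.
`MonomialOrder.degLex` is the graded lexicographic order with `X 0 > X 1 > ⋯`. -/

/-- The initial ideal `in(I)` with respect to the graded lexicographic order: the ideal generated
by the leading terms of all elements of `I`. -/
def initialIdeal {n : ℕ} (I : Ideal (MvPolynomial (Fin n) k)) : Ideal (MvPolynomial (Fin n) k) :=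
  Ideal.span ((MonomialOrder.degLex (σ := Fin n)).leadingTerm '' (I : Set (MvPolynomial (Fin n) k)))

/-- The linear change of coordinates attached to `g ∈ GL_n(k)`: the `k`-algebra endomorphism with
`X j ↦ ∑ i, g i j • X i`. -/
def coordChange {n : ℕ} (g : GL (Fin n) k) : MvPolynomial (Fin n) k →ₐ[k] MvPolynomial (Fin n) k :=
  aeval fun j => ∑ i, C (g i j) * X i

/-- The ideal `g(I)`. (The coordinate change is surjective, so `Ideal.map` is the image.) -/
def transform {n : ℕ} (g : GL (Fin n) k) (I : Ideal (MvPolynomial (Fin n) k)) :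
    Ideal (MvPolynomial (Fin n) k) :=
  I.map (coordChange g)

/-- `U ⊆ GL_n(k)` is Zariski open: its complement is the common zero locus in `GL_n(k)` of a set
of polynomials in the matrix entries. -/
def IsZariskiOpen {n : ℕ} (U : Set (GL (Fin n) k)) : Prop :=
  ∃ S : Set (MvPolynomial (Fin n × Fin n) k),
    U = {g | ∃ p ∈ S, eval (fun ij : Fin n × Fin n => g ij.1 ij.2) p ≠ 0}

/-- `J` is the constant value of `in(g(I))` for `g` in a nonempty Zariski open subset of `GL_n`. -/
def IsGenericInitialIdeal {n : ℕ} (I J : Ideal (MvPolynomial (Fin n) k)) : Prop :=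
  ∃ U : Set (GL (Fin n) k), IsZariskiOpen U ∧ U.Nonempty ∧ ∀ g ∈ U, initialIdeal (transform g I) = J

/-- The generic initial ideal `Gin(I)` for the graded lexicographic order. -/
def gin {n : ℕ} (I : Ideal (MvPolynomial (Fin n) k)) : Ideal (MvPolynomial (Fin n) k) :=
  Classical.epsilon fun J => IsGenericInitialIdeal I J

/-- `I` is in generic coordinates: `in(I) = Gin(I)`. -/
def InGenericCoordinates {n : ℕ} (I : Ideal (MvPolynomial (Fin n) k)) : Prop :=
  initialIdeal I = gin I

/-! ### The maximal degree `M(I)` of a minimal generator of `Gin(I)` -/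

/-- The exponent vectors of the minimal monomial generators of a monomial ideal `J`, i.e. of the
monomials in `J` that are minimal for divisibility. -/
def minGenExponents {n : ℕ} (J : Ideal (MvPolynomial (Fin n) k)) : Set (Fin n →₀ ℕ) :=
  {m | Minimal (fun a : Fin n →₀ ℕ => monomial a (1 : k) ∈ J) m}

theorem minGenExponents_finite {n : ℕ} (J : Ideal (MvPolynomial (Fin n) k)) :
    (minGenExponents J).Finite :=
  WellQuasiOrderedLE.finite_of_isAntichain (setOfPred_minimal_antichain _)

/-- `M(I)`: the maximum of the degrees of the minimal generators of `Gin(I)`. The maximum of the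
empty set (which is the case `I = 0`) is `⊥ = -∞`. -/
def M {n : ℕ} (I : Ideal (MvPolynomial (Fin n) k)) : WithBot ℕ :=
  (minGenExponents_finite (gin I)).toFinset.sup fun m => ((m.degree : ℕ) : WithBot ℕ)

/-! ### Partial elimination ideals -/

/-- `d₀(f)`: the exponent of `X 0` in the leading monomial of `f`. -/
def d₀ {r : ℕ} (f : MvPolynomial (Fin (r + 1)) k) : ℕ :=
  (MonomialOrder.degLex (σ := Fin (r + 1))).degree f 0

theorem d₀_le_iff {r : ℕ} {f : MvPolynomial (Fin (r + 1)) k} {d : ℕ} (hf : f.IsHomogeneous d)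
    (i : ℕ) : d₀ f ≤ i ↔ ∀ m ∈ f.support, m 0 ≤ i := by
  constructor
  · intro h m hm
    refine le_trans ?_ h
    have h1 := (MonomialOrder.degLex (σ := Fin (r + 1))).le_degree hm
    have hne : f ≠ 0 := by rintro rfl; simp at hm
    have hdeg : ∀ a ∈ f.support, a.degree = d := fun a ha => by
      by_contra h'
      exact mem_support_iff.1 ha (hf.coeff_eq_zero h')
    have h2 := hdeg _ hm
    have h3 := hdeg _ (((MonomialOrder.degLex (σ := Fin (r + 1))).degree_mem_support_iff f).2 hne)
    rw [MonomialOrder.degLex_le_iff, Finsupp.DegLex.le_iff] at h1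
    simp only [ofDegLex_toDegLex, h2, h3, lt_irrefl, true_and, false_or] at h1
    rcases h1.eq_or_lt with h1 | h1
    · exact (DFunLike.congr_fun (toLex.injective h1) 0).le
    · obtain ⟨j, hj, hlt⟩ := Finsupp.Lex.lt_iff.1 h1
      rcases eq_or_ne j 0 with rfl | hj0
      · exact hlt.le
      · exact (hj 0 (Fin.pos_of_ne_zero hj0)).le
  · intro h
    rcases eq_or_ne f 0 with rfl | hne
    · simp [d₀]
    · exact h _ (((MonomialOrder.degLex (σ := Fin (r + 1))).degree_mem_support_iff f).2 hne)

/-- `K̃_i(I) = ⨁_d {f ∈ I_d : d₀(f) ≤ i}` for a homogeneous ideal `I`: the elements of `I` all of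
whose homogeneous components `f_d` satisfy `d₀(f_d) ≤ i`. (As `I` is homogeneous, these components
lie in `I`; the zero component has `d₀ 0 = 0`.) -/
def Ktilde {r : ℕ} (i : ℕ) (I : Ideal (MvPolynomial (Fin (r + 1)) k)) :
    Set (MvPolynomial (Fin (r + 1)) k) :=
  {f | f ∈ I ∧ ∀ d, d₀ (homogeneousComponent d f) ≤ i}

theorem mem_Ktilde_iff {r i : ℕ} {I : Ideal (MvPolynomial (Fin (r + 1)) k)}
    {f : MvPolynomial (Fin (r + 1)) k} :
    f ∈ Ktilde i I ↔ f ∈ I ∧ degreeOf 0 f ≤ i := by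
  simp only [Ktilde, Set.mem_ofPred_eq, degreeOf_le_iff]
  refine and_congr_right fun _ => ?_
  simp only [d₀_le_iff (homogeneousComponent_isHomogeneous _ _), mem_support_iff,
    coeff_homogeneousComponent]
  exact ⟨fun h m hm => h m.degree m (by simpa using hm), fun h d m hm => h m (by
    intro h0; simp [h0] at hm)⟩

/-- The map `f ↦ f̄` on `K̃_i(I)`, where `f = X 0 ^ i * f̄ + g` and every monomial of `g` has
`X 0`-exponent less than `i`: the coefficient of `X 0 ^ i` in `f`, seen as a polynomial in `X 0`
over `k[X 1, …, X r]`. The variable `X j` of `MvPolynomial (Fin r) k` stands for `X (j + 1)`. -/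
def bar {r : ℕ} (i : ℕ) (f : MvPolynomial (Fin (r + 1)) k) : MvPolynomial (Fin r) k :=
  (finSuccEquiv k r f).coeff i

theorem finSuccEquiv_rename_succ {r : ℕ} (q : MvPolynomial (Fin r) k) :
    finSuccEquiv k r (rename Fin.succ q) = Polynomial.C q := by
  induction q using MvPolynomial.induction_on with
  | C a => simp [finSuccEquiv_apply]
  | add p q hp hq => simp [hp, hq]
  | mul_X p j hp => simp [hp, finSuccEquiv_X_succ]

/-- The `i`-th partial elimination ideal `K_i(I) ⊆ k[X 1, …, X r]`: the image of `K̃_i(I)` under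
`f ↦ f̄`. -/
def K {r : ℕ} (i : ℕ) (I : Ideal (MvPolynomial (Fin (r + 1)) k)) :
    Ideal (MvPolynomial (Fin r) k) where
  carrier := bar i '' Ktilde i I
  zero_mem' := ⟨0, mem_Ktilde_iff.2 (by simp), by simp [bar]⟩
  add_mem' := by
    rintro _ _ ⟨f, hf, rfl⟩ ⟨g, hg, rfl⟩
    rw [mem_Ktilde_iff] at hf hg
    exact ⟨f + g, mem_Ktilde_iff.2 ⟨I.add_mem hf.1 hg.1,
      (degreeOf_add_le _ _ _).trans (max_le hf.2 hg.2)⟩, by simp [bar]⟩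
  smul_mem' := by
    rintro q _ ⟨f, hf, rfl⟩
    rw [mem_Ktilde_iff] at hf
    have hq := finSuccEquiv_rename_succ q
    refine ⟨rename Fin.succ q * f, mem_Ktilde_iff.2 ⟨I.mul_mem_left _ hf.1, ?_⟩, ?_⟩
    · refine (degreeOf_mul_le _ _ _).trans ?_
      rw [← natDegree_finSuccEquiv (rename Fin.succ q), hq]
      simpa using hf.2
    · simp [bar, hq]

/-- For `f ∈ K̃_i(I)`, the polynomial `bar i f` is the unique `q ∈ k[X 1, …, X r]` such that
`f = X 0 ^ i * q + g` where every monomial of `g` has `X 0`-exponent less than `i`. -/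
theorem bar_eq_iff {r i : ℕ} {I : Ideal (MvPolynomial (Fin (r + 1)) k)}
    {f : MvPolynomial (Fin (r + 1)) k} (hf : f ∈ Ktilde i I) (q : MvPolynomial (Fin r) k) :
    bar i f = q ↔ ∃ g, (∀ m ∈ g.support, m 0 < i) ∧ f = X 0 ^ i * rename Fin.succ q + g := by
  have key : finSuccEquiv k r (X 0 ^ i * rename Fin.succ q) = Polynomial.X ^ i * Polynomial.C q := by
    rw [map_mul, map_pow, finSuccEquiv_rename_succ, finSuccEquiv_X_zero]
  constructor
  · rintro rfl
    refine ⟨f - X 0 ^ i * rename Fin.succ (bar i f), fun m hm => ?_, by ring⟩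
    rw [mem_support_iff, ← Finsupp.cons_tail m, ← finSuccEquiv_coeff_coeff, map_sub, key,
      Polynomial.coeff_sub, mul_comm, Polynomial.coeff_C_mul, Polynomial.coeff_X_pow] at hm
    have hd := (mem_Ktilde_iff.1 hf).2
    by_contra hlt
    rcases (not_lt.1 hlt).eq_or_lt with h | h
    · simp [← h, bar] at hm
    · rw [degreeOf_le_iff] at hd
      rw [if_neg h.ne', mul_zero, sub_zero, finSuccEquiv_coeff_coeff, Finsupp.cons_tail] at hm
      exact absurd (hd m (mem_support_iff.2 hm)) (not_le.2 h)
  · rintro ⟨g, hg, rfl⟩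
    have h0 : (finSuccEquiv k r g).coeff i = 0 := by
      ext m
      rw [finSuccEquiv_coeff_coeff, coeff_zero]
      by_contra h
      exact absurd (hg _ (mem_support_iff.2 h)) (by simp)
    rw [bar, map_add, key, Polynomial.coeff_add, h0, mul_comm, Polynomial.coeff_C_mul,
      Polynomial.coeff_X_pow]
    simp

end PartialElim

end

/-!
Write `N(J)` for the set of exponents of leading monomials of a homogeneous ideal `J`
(`PartialElim.leadExps`), so that the exponents of the minimal monomial generators of `in(J)` are
the minimal elements of `N(J)`. Taking the leading monomial in `X 0` first gives
`u ∈ N(K_i(I)) ↔ cons i u ∈ N(I)` (`mem_leadExps_K`), and the theorem compares the minimal elements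
of `N(I)` with those of its slices. Two facts about generic coordinates enter.

* *Partial elimination ideals inherit generic coordinates* (`gin_K`). For a final segment `T` of the
  exponents of degree `d`, the number of elements of `N(g(I)) ∩ T` is the rank of a matrix whose
  entries are polynomials in the entries of `g`, so the `g` maximizing it form a Zariski open set.
  By Dickson's lemma finitely many such conditions imply all others, which proves that `Gin(I)`
  exists and that it is attained exactly on the set of the `g` that maximize for all `T`
  (`isZariskiOpen_genericLocus_and_nonempty`). If `I` is in generic coordinates, this open set
  contains the identity, hence it meets the subgroup `GL_r` of the changes of `X 1, …, X r` in a
  nonempty open set. As `K_i` commutes with this subgroup, `in(h(K_i(I))) = in(K_i(I))` for all `h`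
  in that set.
* *Exchange* (`exchange_mem_leadExps`). In generic coordinates and characteristic zero, `N(I)` is
  stable under replacing a variable by a larger one. Otherwise a change of coordinates
  `X j ↦ X j + t * X i` would increase one of the numbers above, which are already maximal.

By the exchange property, if `cons i u` is in `N(I)` and `u` has a variable `X j`, then
`cons (i + 1) (u - e_j)` is in `N(I)`. Hence `N(I)` contains the exponent of `X 0 ^ β`, and a
minimal element `u` of the `i`-th slice, `i ≤ β`, does not lie in the slice `i - 1`. So the minimal
elements of `N(I)` are exactly the `cons i u` with `i ≤ β` and `u` minimal in the `i`-th slice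
(`minimal_mem_leadExps_cons_iff`), and the formula follows by comparing degrees.
-/

namespace PartialElim

variable {k : Type*} [Field k] {n r : ℕ}

/-! ### Leading exponents -/

theorem isHomogeneousIdeal_iff {I : Ideal (MvPolynomial (Fin n) k)} :
    IsHomogeneousIdeal I ↔ ∀ f ∈ I, ∀ d, homogeneousComponent d f ∈ I := by
  constructor
  · intro h f hf d
    exact (mem_iff_homogeneousComponent_mem h f).1 hf d
  · intro h d f hf
    have := h f hf d
    rwa [← decomposition.decompose'_apply] at this

/-- The set of exponents of leading monomials of the homogeneous elements of `I`. Among monomials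
of the same degree the graded lexicographic order is the lexicographic one, so only the latter
occurs here. -/
def leadExps (I : Ideal (MvPolynomial (Fin n) k)) : Set (Fin n →₀ ℕ) :=
  {m | ∃ f ∈ I, f.IsHomogeneous m.degree ∧ coeff m f ≠ 0 ∧ ∀ u, toLex m < toLex u → coeff u f = 0}

theorem add_mem_leadExps {I : Ideal (MvPolynomial (Fin n) k)} {m : Fin n →₀ ℕ}
    (hm : m ∈ leadExps I) (a : Fin n →₀ ℕ) : a + m ∈ leadExps I := by
  obtain ⟨f, hf, hd, hc, hl⟩ := hm
  refine ⟨monomial a 1 * f, I.mul_mem_left _ hf, ?_, by simpa using hc, fun u hu => ?_⟩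
  · rw [map_add]
    exact (isHomogeneous_monomial 1 rfl).mul hd
  · rw [coeff_monomial_mul']
    split_ifs with h
    · rw [hl, mul_zero]
      obtain ⟨v, rfl⟩ := le_iff_exists_add.1 h
      rw [toLex_add, toLex_add] at hu
      simpa using lt_of_add_lt_add_left hu
    · rfl

theorem mem_leadExps_of_le {I : Ideal (MvPolynomial (Fin n) k)} {m u : Fin n →₀ ℕ}
    (hm : m ∈ leadExps I) (h : m ≤ u) : u ∈ leadExps I := by
  obtain ⟨a, rfl⟩ := le_iff_exists_add'.1 h
  exact add_mem_leadExps hm a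

theorem leadExps_eq_image_degree {I : Ideal (MvPolynomial (Fin n) k)} (hI : IsHomogeneousIdeal I) :
    leadExps I = (MonomialOrder.degLex (σ := Fin n)).degree ''
      ((I : Set (MvPolynomial (Fin n) k)) \ {0}) := by
  ext m
  constructor
  · rintro ⟨f, hf, hd, hc, hl⟩
    have hf0 : f ≠ 0 := by rintro rfl; simp at hc
    refine ⟨f, ⟨hf, hf0⟩, ?_⟩
    set v := (MonomialOrder.degLex (σ := Fin n)).degree f with hv
    have h1 := (MonomialOrder.degLex (σ := Fin n)).le_degree (mem_support_iff.2 hc)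
    have hvs : coeff v f ≠ 0 :=
      mem_support_iff.1 ((MonomialOrder.degLex (σ := Fin n)).degree_mem_support hf0)
    have h2 : v.degree = m.degree := by
      by_contra h
      exact hvs (hd.coeff_eq_zero h)
    rw [← hv, MonomialOrder.degLex_le_iff, Finsupp.DegLex.le_iff] at h1
    simp only [ofDegLex_toDegLex, h2, lt_irrefl, true_and, false_or] at h1
    rcases h1.eq_or_lt with h1 | h1
    · exact (toLex.injective h1).symm
    · exact absurd (hl _ h1) hvs
  · rintro ⟨f, ⟨hf, hf0⟩, rfl⟩
    set v := (MonomialOrder.degLex (σ := Fin n)).degree f with hv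
    have hvs : coeff v f ≠ 0 :=
      mem_support_iff.1 ((MonomialOrder.degLex (σ := Fin n)).degree_mem_support hf0)
    refine ⟨homogeneousComponent v.degree f, isHomogeneousIdeal_iff.1 hI f hf _,
      homogeneousComponent_isHomogeneous _ _, by rwa [coeff_homogeneousComponent, if_pos rfl],
      fun u hu => ?_⟩
    rw [coeff_homogeneousComponent]
    split_ifs with h
    · by_contra hne
      have h1 := (MonomialOrder.degLex (σ := Fin n)).le_degree (mem_support_iff.2 hne)
      rw [← hv, MonomialOrder.degLex_le_iff, Finsupp.DegLex.le_iff] at h1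
      simp only [ofDegLex_toDegLex, h, lt_irrefl, true_and, false_or] at h1
      exact absurd hu (not_lt.2 h1)
    · rfl

theorem initialIdeal_eq_span {I : Ideal (MvPolynomial (Fin n) k)} (hI : IsHomogeneousIdeal I) :
    initialIdeal I = Ideal.span ((fun m => monomial m (1 : k)) '' leadExps I) := by
  rw [initialIdeal, MonomialOrder.span_leadingTerm_eq_span_monomial', leadExps_eq_image_degree hI,
    Set.image_image]

theorem monomial_mem_initialIdeal {I : Ideal (MvPolynomial (Fin n) k)} (hI : IsHomogeneousIdeal I)
    {m : Fin n →₀ ℕ} : monomial m (1 : k) ∈ initialIdeal I ↔ m ∈ leadExps I := by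
  rw [initialIdeal_eq_span hI, mem_ideal_span_monomial_image]
  constructor
  · intro h
    obtain ⟨u, hu, hle⟩ := h m (by simp)
    exact mem_leadExps_of_le hu hle
  · intro h u hu
    have := support_monomial_subset hu
    rw [Finset.mem_singleton] at this
    exact ⟨m, h, this.ge⟩

theorem initialIdeal_eq_iff {I J : Ideal (MvPolynomial (Fin n) k)} (hI : IsHomogeneousIdeal I)
    (hJ : IsHomogeneousIdeal J) : initialIdeal I = initialIdeal J ↔ leadExps I = leadExps J := by
  constructor
  · intro h
    ext m
    rw [← monomial_mem_initialIdeal hI, h, monomial_mem_initialIdeal hJ]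
  · intro h
    rw [initialIdeal_eq_span hI, h, initialIdeal_eq_span hJ]

/-! ### Linear changes of coordinates -/

theorem coordChange_X (g : GL (Fin n) k) (j : Fin n) :
    coordChange g (X j) = ∑ i, C (g i j) * X i := by
  simp [coordChange]

theorem coordChange_mul (g h : GL (Fin n) k) (f : MvPolynomial (Fin n) k) :
    coordChange (g * h) f = coordChange g (coordChange h f) := by
  rw [← AlgHom.comp_apply]
  refine DFunLike.congr_fun (MvPolynomial.algHom_ext fun j => ?_) f
  simp only [AlgHom.comp_apply, coordChange_X, map_sum, map_mul, Units.val_mul, Matrix.mul_apply,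
    algHom_C, algebraMap_eq, Finset.mul_sum, Finset.sum_mul]
  rw [Finset.sum_comm]
  exact Finset.sum_congr rfl fun _ _ => Finset.sum_congr rfl fun _ _ => by ring

theorem coordChange_one (f : MvPolynomial (Fin n) k) : coordChange 1 f = f := by
  rw [← AlgHom.id_apply (R := k) f, ← AlgHom.comp_apply]
  refine DFunLike.congr_fun (MvPolynomial.algHom_ext fun j => ?_) f
  simp [coordChange_X, Matrix.one_apply, apply_ite C, ite_mul]

theorem coordChange_inv_apply (g : GL (Fin n) k) (f : MvPolynomial (Fin n) k) :
    coordChange g⁻¹ (coordChange g f) = f := by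
  rw [← coordChange_mul, inv_mul_cancel, coordChange_one]

theorem mem_transform {g : GL (Fin n) k} {I : Ideal (MvPolynomial (Fin n) k)}
    {f : MvPolynomial (Fin n) k} : f ∈ transform g I ↔ coordChange g⁻¹ f ∈ I := by
  constructor
  · intro h
    have := Ideal.mem_map_of_mem (coordChange g⁻¹) h
    rw [transform, Ideal.map_mapₐ] at this
    refine Ideal.map_le_iff_le_comap.2 (fun x hx => ?_) this
    simpa [coordChange_inv_apply] using hx
  · intro h
    have := Ideal.mem_map_of_mem (coordChange g) h
    rwa [← coordChange_mul, mul_inv_cancel, coordChange_one] at this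

theorem coordChange_mem_transform {g : GL (Fin n) k} {I : Ideal (MvPolynomial (Fin n) k)}
    {f : MvPolynomial (Fin n) k} (hf : f ∈ I) : coordChange g f ∈ transform g I :=
  Ideal.mem_map_of_mem _ hf

theorem transform_one (I : Ideal (MvPolynomial (Fin n) k)) : transform 1 I = I := by
  ext f
  rw [mem_transform, inv_one, coordChange_one]

theorem transform_transform (g h : GL (Fin n) k) (I : Ideal (MvPolynomial (Fin n) k)) :
    transform g (transform h I) = transform (g * h) I := by
  ext f
  rw [mem_transform, mem_transform, mem_transform, mul_inv_rev, coordChange_mul]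

theorem isHomogeneous_coordChange (g : GL (Fin n) k) {f : MvPolynomial (Fin n) k} {d : ℕ}
    (hf : f.IsHomogeneous d) : (coordChange g f).IsHomogeneous d := by
  have := hf.aeval (fun j => ∑ i, C (g i j) * X i) (n := 1) fun j =>
    IsHomogeneous.sum _ _ _ fun i _ => isHomogeneous_C_mul_X _ _
  rwa [one_mul] at this

theorem homogeneousComponent_coordChange (g : GL (Fin n) k) (f : MvPolynomial (Fin n) k) (d : ℕ) :
    homogeneousComponent d (coordChange g f) = coordChange g (homogeneousComponent d f) := by
  conv_lhs => rw [← sum_homogeneousComponent f, map_sum, map_sum]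
  simp_rw [homogeneousComponent_of_mem
    (isHomogeneous_coordChange g (homogeneousComponent_isHomogeneous _ f))]
  rw [Finset.sum_ite_eq]
  split_ifs with h
  · rfl
  · rw [homogeneousComponent_eq_zero _ _ (by simpa using h), map_zero]

theorem isHomogeneousIdeal_transform (g : GL (Fin n) k) {I : Ideal (MvPolynomial (Fin n) k)}
    (hI : IsHomogeneousIdeal I) : IsHomogeneousIdeal (transform g I) := by
  rw [isHomogeneousIdeal_iff] at hI ⊢
  intro f hf d
  rw [mem_transform] at hf ⊢
  rw [← homogeneousComponent_coordChange]
  exact hI _ hf d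

/-! ### Counting leading exponents -/

/-- `T` is a final segment, for the lexicographic order, of the set of exponents of degree `d`. -/
structure IsFinalSegment (d : ℕ) (T : Finset (Fin n →₀ ℕ)) : Prop where
  degree_eq : ∀ u ∈ T, u.degree = d
  mem_of_le : ∀ u ∈ T, ∀ v : Fin n →₀ ℕ, v.degree = d → toLex u ≤ toLex v → v ∈ T

open Classical in
/-- The leading exponents of `I` lying in `T`. For a final segment `T` in degree `d`, their number
is the rank of the projection of `I_d` to the span of the monomials with exponent in `T`. -/
noncomputable def leadFinset (I : Ideal (MvPolynomial (Fin n) k)) (T : Finset (Fin n →₀ ℕ)) :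
    Finset (Fin n →₀ ℕ) :=
  T.filter (· ∈ leadExps I)

theorem mem_leadFinset {I : Ideal (MvPolynomial (Fin n) k)} {T : Finset (Fin n →₀ ℕ)}
    {u : Fin n →₀ ℕ} : u ∈ leadFinset I T ↔ u ∈ T ∧ u ∈ leadExps I := by
  simp [leadFinset]

theorem leadFinset_subset (I : Ideal (MvPolynomial (Fin n) k)) (T : Finset (Fin n →₀ ℕ)) :
    leadFinset I T ⊆ T := fun _ hu => (mem_leadFinset.1 hu).1

/-- If the `f i ∈ J_d` are linearly independent modulo the monomials outside of `T`, then `T`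
contains at least as many leading exponents of `J`. Otherwise some nontrivial linear combination
of the `f i` would vanish at all leading exponents in `T`, although its own leading exponent is one
of them. -/
theorem card_le_card_leadFinset {J : Ideal (MvPolynomial (Fin n) k)} {d : ℕ}
    {T : Finset (Fin n →₀ ℕ)} (hT : IsFinalSegment d T) {ι : Type*} [Fintype ι]
    (f : ι → MvPolynomial (Fin n) k) (hf : ∀ i, f i ∈ J) (hd : ∀ i, (f i).IsHomogeneous d)
    (hind : ∀ c : ι → k, (∀ u ∈ T, coeff u (∑ i, c i • f i) = 0) → c = 0) :
    Fintype.card ι ≤ (leadFinset J T).card := by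
  by_contra! hlt
  let φ : (ι → k) →ₗ[k] (leadFinset J T → k) :=
    LinearMap.pi fun s => (lcoeff k s.1).comp (Fintype.linearCombination k f)
  have hker : LinearMap.ker φ ≠ ⊥ := LinearMap.ker_ne_bot_of_finrank_lt (by simpa using hlt)
  obtain ⟨c, hc, hc0⟩ := Submodule.exists_mem_ne_zero_of_ne_bot hker
  have hφ : ∀ s ∈ leadFinset J T, coeff s (∑ i, c i • f i) = 0 := fun s hs => by
    have := congrFun (LinearMap.mem_ker.1 hc) ⟨s, hs⟩
    simpa [φ, Fintype.linearCombination_apply, coeff_sum] using this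
  obtain ⟨u, hu, hne⟩ : ∃ u ∈ T, coeff u (∑ i, c i • f i) ≠ 0 := by
    by_contra! h
    exact hc0 (hind c h)
  set g := ∑ i, c i • f i with hg
  have hgd : g.IsHomogeneous d := IsHomogeneous.sum _ _ _ fun i _ => by
    rw [smul_eq_C_mul]
    exact (hd i).C_mul _
  have hgJ : g ∈ J := J.sum_mem fun i _ => by
    rw [smul_eq_C_mul]
    exact J.mul_mem_left _ (hf i)
  obtain ⟨v, hv, hmax⟩ := Finset.exists_max_image g.support toLex ⟨u, mem_support_iff.2 hne⟩
  have hvd : v.degree = d := by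
    by_contra h
    exact mem_support_iff.1 hv (hgd.coeff_eq_zero h)
  refine mem_support_iff.1 hv (hφ v (mem_leadFinset.2
    ⟨hT.mem_of_le u hu v hvd (hmax u (mem_support_iff.2 hne)), g, hgJ, hvd ▸ hgd,
      mem_support_iff.1 hv, fun w hw => ?_⟩))
  by_contra hne'
  exact absurd hw (not_lt.2 (hmax w (mem_support_iff.2 hne')))

theorem eq_zero_of_det_ne_zero {S : Finset (Fin n →₀ ℕ)} {f : S → MvPolynomial (Fin n) k}
    (hdet : (Matrix.of fun s u : S => coeff u.1 (f s)).det ≠ 0) {c : S → k}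
    (hc : ∀ u ∈ S, coeff u (∑ s, c s • f s) = 0) : c = 0 := by
  refine Matrix.eq_zero_of_vecMul_eq_zero hdet (funext fun u => ?_)
  simpa [Matrix.vecMul, dotProduct, coeff_sum] using hc u.1 u.2

theorem card_le_card_leadFinset_of_det_ne_zero {J : Ideal (MvPolynomial (Fin n) k)} {d : ℕ}
    {T S : Finset (Fin n →₀ ℕ)} (hT : IsFinalSegment d T) (hS : S ⊆ T)
    (f : S → MvPolynomial (Fin n) k) (hf : ∀ i, f i ∈ J) (hd : ∀ i, (f i).IsHomogeneous d)
    (hdet : (Matrix.of fun s u : S => coeff u.1 (f s)).det ≠ 0) :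
    S.card ≤ (leadFinset J T).card := by
  rw [← Fintype.card_coe]
  exact card_le_card_leadFinset hT f hf hd fun c hc =>
    eq_zero_of_det_ne_zero hdet fun u hu => hc u (hS hu)

theorem det_ne_zero_of_triangular {R : Type*} [CommRing R] [IsDomain R]
    {S : Finset (Fin n →₀ ℕ)} (A : Matrix S S R)
    (h : ∀ s u : S, toLex s.1 < toLex u.1 → A s u = 0) (hdiag : ∀ s, A s s ≠ 0) : A.det ≠ 0 := by
  intro hdet
  obtain ⟨v, hv0, hv⟩ := Matrix.exists_vecMul_eq_zero_iff.2 hdet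
  obtain ⟨s₀, hs₀⟩ := Function.ne_iff.1 hv0
  obtain ⟨s, hs, hmax⟩ := Set.exists_max_image {s | v s ≠ 0} (fun s : S => toLex s.1)
    (Set.toFinite _) ⟨s₀, hs₀⟩
  have := congrFun hv s
  rw [Matrix.vecMul, dotProduct, Finset.sum_eq_single s] at this
  · exact (mul_ne_zero hs (hdiag s)) this
  · intro t _ hts
    by_cases hvt : v t = 0
    · rw [hvt, zero_mul]
    · rw [h t s, mul_zero]
      refine lt_of_le_of_ne (hmax t hvt) fun h' => hts (Subtype.ext (toLex.injective h'))
  · simp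

/-- Elements of `J` leading at the leading exponents in `T`. Their coefficients at these exponents
form a triangular matrix with nonzero diagonal. -/
theorem exists_family_leadFinset (J : Ideal (MvPolynomial (Fin n) k)) {d : ℕ}
    {T : Finset (Fin n →₀ ℕ)} (hT : IsFinalSegment d T) :
    ∃ f : leadFinset J T → MvPolynomial (Fin n) k, (∀ s, f s ∈ J) ∧ (∀ s, (f s).IsHomogeneous d) ∧
      (∀ s, coeff s.1 (f s) ≠ 0) ∧ ∀ s u, toLex s.1 < toLex u → coeff u (f s) = 0 := by
  have : ∀ s : leadFinset J T, ∃ f ∈ J, f.IsHomogeneous d ∧ coeff s.1 f ≠ 0 ∧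
      ∀ u, toLex s.1 < toLex u → coeff u f = 0 := fun s => by
    obtain ⟨f, hf, hd, h1, h2⟩ := (mem_leadFinset.1 s.2).2
    rw [hT.degree_eq _ (mem_leadFinset.1 s.2).1] at hd
    exact ⟨f, hf, hd, h1, h2⟩
  choose f h1 h2 h3 h4 using this
  exact ⟨f, h1, h2, h3, h4⟩

theorem eq_of_coeff_degree_eq {f g : MvPolynomial (Fin n) k} {d : ℕ} (hf : f.IsHomogeneous d)
    (hg : g.IsHomogeneous d) (h : ∀ u : Fin n →₀ ℕ, u.degree = d → coeff u f = coeff u g) :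
    f = g := by
  ext u
  by_cases hu : u.degree = d
  · exact h u hu
  · rw [hf.coeff_eq_zero hu, hg.coeff_eq_zero hu]

/-- The exponents of degree `d`. -/
noncomputable def degreeFinset (n d : ℕ) : Finset (Fin n →₀ ℕ) :=
  Finset.finsuppAntidiag Finset.univ d

theorem mem_degreeFinset {d : ℕ} {u : Fin n →₀ ℕ} : u ∈ degreeFinset n d ↔ u.degree = d := by
  simp [degreeFinset, Finset.mem_finsuppAntidiag, Finsupp.degree_eq_sum]

theorem isFinalSegment_degreeFinset (n d : ℕ) : IsFinalSegment d (degreeFinset n d) :=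
  ⟨fun _ hu => mem_degreeFinset.1 hu, fun _ _ _ hv _ => mem_degreeFinset.2 hv⟩

/-- The exponents of the degree of `m` that are lexicographically at least `m`. -/
noncomputable def upperFinset (m : Fin n →₀ ℕ) : Finset (Fin n →₀ ℕ) :=
  (degreeFinset n m.degree).filter fun u => toLex m ≤ toLex u

/-- The exponents of the degree of `m` that are lexicographically greater than `m`. -/
noncomputable def strictUpperFinset (m : Fin n →₀ ℕ) : Finset (Fin n →₀ ℕ) :=
  (degreeFinset n m.degree).filter fun u => toLex m < toLex u

theorem mem_upperFinset {m u : Fin n →₀ ℕ} :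
    u ∈ upperFinset m ↔ u.degree = m.degree ∧ toLex m ≤ toLex u := by
  simp [upperFinset, mem_degreeFinset]

theorem mem_strictUpperFinset {m u : Fin n →₀ ℕ} :
    u ∈ strictUpperFinset m ↔ u.degree = m.degree ∧ toLex m < toLex u := by
  simp [strictUpperFinset, mem_degreeFinset]

theorem isFinalSegment_upperFinset (m : Fin n →₀ ℕ) :
    IsFinalSegment m.degree (upperFinset m) :=
  ⟨fun _ hu => (mem_upperFinset.1 hu).1, fun _ hu _ hv h =>
    mem_upperFinset.2 ⟨hv, (mem_upperFinset.1 hu).2.trans h⟩⟩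

theorem isFinalSegment_strictUpperFinset (m : Fin n →₀ ℕ) :
    IsFinalSegment m.degree (strictUpperFinset m) :=
  ⟨fun _ hu => (mem_strictUpperFinset.1 hu).1, fun _ hu _ hv h =>
    mem_strictUpperFinset.2 ⟨hv, (mem_strictUpperFinset.1 hu).2.trans_le h⟩⟩

theorem mem_leadExps_iff_card {I : Ideal (MvPolynomial (Fin n) k)} {m : Fin n →₀ ℕ} :
    m ∈ leadExps I ↔
      (leadFinset I (strictUpperFinset m)).card < (leadFinset I (upperFinset m)).card := by
  have hsub : leadFinset I (strictUpperFinset m) ⊆ leadFinset I (upperFinset m) := fun u hu => by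
    simp only [mem_leadFinset, mem_strictUpperFinset, mem_upperFinset] at hu ⊢
    exact ⟨⟨hu.1.1, hu.1.2.le⟩, hu.2⟩
  constructor
  · intro hm
    refine Finset.card_lt_card (Finset.ssubset_iff_subset_ne.2 ⟨hsub, fun h => ?_⟩)
    have : m ∈ leadFinset I (upperFinset m) :=
      mem_leadFinset.2 ⟨mem_upperFinset.2 ⟨rfl, le_rfl⟩, hm⟩
    rw [← h, mem_leadFinset, mem_strictUpperFinset] at this
    exact lt_irrefl _ this.1.2
  · intro h
    obtain ⟨u, hu, hu'⟩ := Finset.exists_mem_notMem_of_card_lt_card h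
    simp only [mem_leadFinset, mem_strictUpperFinset, mem_upperFinset] at hu hu'
    have : toLex m = toLex u := hu.1.2.eq_or_lt.resolve_right fun h => hu' ⟨⟨hu.1.1, h⟩, hu.2⟩
    rw [toLex.injective this]
    exact hu.2

/-- A linear change of coordinates does not change the number of leading exponents in a given
degree, which is the dimension of `I_d`. -/
theorem card_leadFinset_degreeFinset_le (I : Ideal (MvPolynomial (Fin n) k)) (g : GL (Fin n) k)
    (d : ℕ) : (leadFinset I (degreeFinset n d)).card ≤
      (leadFinset (transform g I) (degreeFinset n d)).card := by
  have hT := isFinalSegment_degreeFinset n d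
  obtain ⟨f, hf, hd, hlead, hlt⟩ := exists_family_leadFinset I hT
  rw [← Fintype.card_coe]
  refine card_le_card_leadFinset hT (fun s => coordChange g (f s))
    (fun s => coordChange_mem_transform (hf s)) (fun s => isHomogeneous_coordChange g (hd s))
    fun c hc => ?_
  have hsum : ∑ s, c s • coordChange g (f s) = coordChange g (∑ s, c s • f s) := by simp
  have hhom : (∑ s, c s • f s).IsHomogeneous d := IsHomogeneous.sum _ _ _ fun i _ => by
    rw [smul_eq_C_mul]
    exact (hd i).C_mul _
  rw [hsum] at hc
  have h0 : coordChange g (∑ s, c s • f s) = 0 :=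
    eq_of_coeff_degree_eq (isHomogeneous_coordChange g hhom) (isHomogeneous_zero _ _ _)
      fun u hu => by rw [hc u (mem_degreeFinset.2 hu), coeff_zero]
  have h1 : ∑ s, c s • f s = 0 := by
    rw [← coordChange_inv_apply g (∑ s, c s • f s), h0, map_zero]
  refine eq_zero_of_det_ne_zero (det_ne_zero_of_triangular _ (fun s u h => hlt s u h) hlead) ?_
  exact fun u _ => by rw [h1, coeff_zero]

/-! ### The Zariski topology on the general linear group -/

/-- The value at the entries of `g`, as a ring homomorphism. -/
noncomputable def evalEntries (g : GL (Fin n) k) : MvPolynomial (Fin n × Fin n) k →+* k :=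
  eval fun ij : Fin n × Fin n => g ij.1 ij.2

theorem isZariskiOpen_iff {U : Set (GL (Fin n) k)} :
    IsZariskiOpen U ↔ ∀ g ∈ U, ∃ p, evalEntries g p ≠ 0 ∧ ∀ h, evalEntries h p ≠ 0 → h ∈ U := by
  constructor
  · rintro ⟨S, rfl⟩ g ⟨p, hp, hne⟩
    exact ⟨p, hne, fun h hh => ⟨p, hp, hh⟩⟩
  · intro H
    refine ⟨{p | ∀ h, evalEntries h p ≠ 0 → h ∈ U}, Set.ext fun g => ⟨fun hg => ?_, ?_⟩⟩
    · obtain ⟨p, hp, hpU⟩ := H g hg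
      exact ⟨p, hpU, hp⟩
    · rintro ⟨p, hp, hne⟩
      exact hp g hne

theorem isZariskiOpen_univ : IsZariskiOpen (Set.univ : Set (GL (Fin n) k)) :=
  isZariskiOpen_iff.2 fun _ _ => ⟨1, by simp, fun _ _ => trivial⟩

theorem IsZariskiOpen.inter {U V : Set (GL (Fin n) k)} (hU : IsZariskiOpen U)
    (hV : IsZariskiOpen V) : IsZariskiOpen (U ∩ V) := by
  rw [isZariskiOpen_iff] at *
  rintro g ⟨hgU, hgV⟩
  obtain ⟨p, hp, hpU⟩ := hU g hgU
  obtain ⟨q, hq, hqV⟩ := hV g hgV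
  refine ⟨p * q, by simp [hp, hq], fun h hh => ?_⟩
  rw [map_mul] at hh
  exact ⟨hpU h (left_ne_zero_of_mul hh), hqV h (right_ne_zero_of_mul hh)⟩

/-- The general linear group over an infinite field is irreducible: two nonempty Zariski open
subsets meet. -/
theorem IsZariskiOpen.inter_nonempty [Infinite k] {U V : Set (GL (Fin n) k)}
    (hU : IsZariskiOpen U) (hV : IsZariskiOpen V) (hU' : U.Nonempty) (hV' : V.Nonempty) :
    (U ∩ V).Nonempty := by
  obtain ⟨g, hg⟩ := hU'
  obtain ⟨g', hg'⟩ := hV'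
  obtain ⟨p, hp, hpU⟩ := isZariskiOpen_iff.1 hU g hg
  obtain ⟨q, hq, hqV⟩ := isZariskiOpen_iff.1 hV g' hg'
  have hp0 : p ≠ 0 := by rintro rfl; simp at hp
  have hq0 : q ≠ 0 := by rintro rfl; simp at hq
  -- the determinant of the matrix of variables keeps the chosen point inside `GL_n`
  let δ : MvPolynomial (Fin n × Fin n) k := (Matrix.of fun i j => X (i, j) : Matrix _ _ _).det
  have hδ : ∀ x : Fin n × Fin n → k, eval x δ = (Matrix.of fun i j => x (i, j)).det := fun x => by
    rw [RingHom.map_det]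
    congr 1
    ext i j
    simp
  have hδ0 : δ ≠ 0 := fun h => by
    have := hδ fun ij => (1 : Matrix (Fin n) (Fin n) k) ij.1 ij.2
    rw [h, map_zero] at this
    exact zero_ne_one (this.trans Matrix.det_one)
  have hne : p * q * δ ≠ 0 := mul_ne_zero (mul_ne_zero hp0 hq0) hδ0
  obtain ⟨x, hx⟩ : ∃ x, eval x (p * q * δ) ≠ 0 := by
    by_contra! h
    exact hne (MvPolynomial.funext fun x => by rw [h x, map_zero])
  rw [map_mul, map_mul, hδ] at hx
  let G : GL (Fin n) k := Matrix.GeneralLinearGroup.mkOfDetNeZero _ (right_ne_zero_of_mul hx)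
  exact ⟨G, hpU G (left_ne_zero_of_mul (left_ne_zero_of_mul hx)),
    hqV G (right_ne_zero_of_mul (left_ne_zero_of_mul hx))⟩

theorem isZariskiOpen_biInter_and_nonempty [Infinite k] {α : Type*} (F : Finset α)
    (U : α → Set (GL (Fin n) k)) (hU : ∀ a ∈ F, IsZariskiOpen (U a) ∧ (U a).Nonempty) :
    IsZariskiOpen (⋂ a ∈ F, U a) ∧ (⋂ a ∈ F, U a).Nonempty := by
  classical
  induction F using Finset.induction_on with
  | empty => simpa using isZariskiOpen_univ
  | insert a s ha ih =>
    rw [Finset.set_biInter_insert]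
    have h1 := hU a (Finset.mem_insert_self a s)
    have h2 := ih fun b hb => hU b (Finset.mem_insert_of_mem hb)
    exact ⟨h1.1.inter h2.1, h1.1.inter_nonempty h2.1 h1.2 h2.2⟩

theorem IsGenericInitialIdeal.unique [Infinite k] {I J J' : Ideal (MvPolynomial (Fin n) k)}
    (h : IsGenericInitialIdeal I J) (h' : IsGenericInitialIdeal I J') : J = J' := by
  obtain ⟨U, hU, hne, hUJ⟩ := h
  obtain ⟨V, hV, hne', hVJ⟩ := h'
  obtain ⟨g, hgU, hgV⟩ := hU.inter_nonempty hV hne hne'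
  rw [← hUJ g hgU, hVJ g hgV]

theorem IsGenericInitialIdeal.gin_eq [Infinite k] {I J : Ideal (MvPolynomial (Fin n) k)}
    (h : IsGenericInitialIdeal I J) : gin I = J :=
  IsGenericInitialIdeal.unique (Classical.epsilon_spec (p := IsGenericInitialIdeal I) ⟨J, h⟩) h

/-! ### Existence of the generic initial ideal -/

/-- The change of coordinates given by the matrix of variables. -/
noncomputable def genericChange :
    MvPolynomial (Fin n) k →ₐ[k] MvPolynomial (Fin n) (MvPolynomial (Fin n × Fin n) k) :=
  aeval fun j => ∑ i, C (X (i, j)) * X i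

theorem map_genericChange (g : GL (Fin n) k) (f : MvPolynomial (Fin n) k) :
    map (evalEntries g) (genericChange f) = coordChange g f := by
  induction f using MvPolynomial.induction_on with
  | C a =>
    rw [← algebraMap_eq, AlgHom.commutes, AlgHom.commutes, MvPolynomial.algebraMap_apply, map_C,
      algebraMap_eq, algebraMap_eq, evalEntries, eval_C]
  | add p q hp hq => rw [map_add, map_add, map_add, hp, hq]
  | mul_X p j hp =>
    rw [map_mul, map_mul, map_mul, hp, coordChange_X]
    simp [genericChange, evalEntries]

theorem evalEntries_coeff_genericChange (g : GL (Fin n) k) (f : MvPolynomial (Fin n) k)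
    (u : Fin n →₀ ℕ) : evalEntries g (coeff u (genericChange f)) = coeff u (coordChange g f) := by
  rw [← map_genericChange, coeff_map]

/-- The changes of coordinates `g` for which the number of leading exponents of `g(I)` in `T` is
as large as possible. -/
def maximizers (I : Ideal (MvPolynomial (Fin n) k)) (T : Finset (Fin n →₀ ℕ)) :
    Set (GL (Fin n) k) :=
  {g | ∀ h, (leadFinset (transform h I) T).card ≤ (leadFinset (transform g I) T).card}

theorem card_leadFinset_eq_of_mem_maximizers {I : Ideal (MvPolynomial (Fin n) k)}
    {T : Finset (Fin n →₀ ℕ)} {g h : GL (Fin n) k} (hg : g ∈ maximizers I T)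
    (hh : h ∈ maximizers I T) :
    (leadFinset (transform g I) T).card = (leadFinset (transform h I) T).card :=
  le_antisymm (hh g) (hg h)

theorem maximizers_nonempty (I : Ideal (MvPolynomial (Fin n) k)) (T : Finset (Fin n →₀ ℕ)) :
    (maximizers I T).Nonempty := by
  have hfin : (Set.range fun g : GL (Fin n) k => (leadFinset (transform g I) T).card).Finite :=
    (Set.finite_Iic T.card).subset (by
      rintro _ ⟨g, rfl⟩
      exact Finset.card_le_card (leadFinset_subset _ _))
  obtain ⟨_, ⟨g, rfl⟩, hg⟩ := Set.exists_max_image _ id hfin (Set.range_nonempty _)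
  exact ⟨g, fun h => hg _ ⟨h, rfl⟩⟩

/-- Having many leading exponents in `T` is a Zariski open condition on `g`: it is expressed by a
minor of the coefficient matrix of elements of `g(I)`. -/
theorem isZariskiOpen_maximizers (I : Ideal (MvPolynomial (Fin n) k)) {d : ℕ}
    {T : Finset (Fin n →₀ ℕ)} (hT : IsFinalSegment d T) : IsZariskiOpen (maximizers I T) := by
  rw [isZariskiOpen_iff]
  intro g hg
  obtain ⟨f, hf, hd, hlead, hlt⟩ := exists_family_leadFinset (transform g I) hT
  let B : Matrix (leadFinset (transform g I) T) (leadFinset (transform g I) T)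
      (MvPolynomial (Fin n × Fin n) k) :=
    Matrix.of fun s u => coeff u.1 (genericChange (coordChange g⁻¹ (f s)))
  have hB : ∀ h : GL (Fin n) k, evalEntries h B.det =
      (Matrix.of fun s u : leadFinset (transform g I) T =>
        coeff u.1 (coordChange h (coordChange g⁻¹ (f s)))).det := fun h => by
    rw [RingHom.map_det]
    congr 1
    ext s u
    exact evalEntries_coeff_genericChange _ _ _
  refine ⟨B.det, ?_, fun h hh h' => (hg h').trans ?_⟩
  · rw [hB]
    simp only [← coordChange_mul, mul_inv_cancel, coordChange_one]
    exact det_ne_zero_of_triangular _ (fun s u h => hlt s u h) hlead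
  · rw [hB] at hh
    exact card_le_card_leadFinset_of_det_ne_zero hT (leadFinset_subset _ _) _
      (fun s => coordChange_mem_transform (mem_transform.1 (hf s)))
      (fun s => isHomogeneous_coordChange _ (isHomogeneous_coordChange _ (hd s))) hh

/-- The changes of coordinates `g` for which `g(I)` has as many leading exponents as possible in
every final segment. -/
def genericLocus (I : Ideal (MvPolynomial (Fin n) k)) : Set (GL (Fin n) k) :=
  {g | ∀ d T, IsFinalSegment d T → g ∈ maximizers I T}

theorem leadExps_eq_of_mem_genericLocus {I : Ideal (MvPolynomial (Fin n) k)} {g h : GL (Fin n) k}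
    (hg : g ∈ genericLocus I) (hh : h ∈ genericLocus I) :
    leadExps (transform g I) = leadExps (transform h I) := by
  ext m
  rw [mem_leadExps_iff_card, mem_leadExps_iff_card,
    card_leadFinset_eq_of_mem_maximizers (hg _ _ (isFinalSegment_upperFinset m))
      (hh _ _ (isFinalSegment_upperFinset m)),
    card_leadFinset_eq_of_mem_maximizers (hg _ _ (isFinalSegment_strictUpperFinset m))
      (hh _ _ (isFinalSegment_strictUpperFinset m))]

theorem mem_genericLocus_of_leadExps_eq {I : Ideal (MvPolynomial (Fin n) k)} {g h : GL (Fin n) k}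
    (hg : g ∈ genericLocus I) (heq : leadExps (transform h I) = leadExps (transform g I)) :
    h ∈ genericLocus I := by
  intro d T hT h'
  have : leadFinset (transform h I) T = leadFinset (transform g I) T := by
    ext u
    rw [mem_leadFinset, mem_leadFinset, heq]
  rw [this]
  exact hg d T hT h'

theorem mem_leadExps_iff_of_mem_maximizers {I : Ideal (MvPolynomial (Fin n) k)}
    {m : Fin n →₀ ℕ} {g h : GL (Fin n) k}
    (hg : g ∈ maximizers I (upperFinset m)) (hg' : g ∈ maximizers I (strictUpperFinset m))
    (hh : h ∈ maximizers I (upperFinset m)) (hh' : h ∈ maximizers I (strictUpperFinset m)) :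
    m ∈ leadExps (transform g I) ↔ m ∈ leadExps (transform h I) := by
  rw [mem_leadExps_iff_card, mem_leadExps_iff_card, card_leadFinset_eq_of_mem_maximizers hg hh,
    card_leadFinset_eq_of_mem_maximizers hg' hh']

/-- Although it is defined by infinitely many conditions, the generic locus is a nonempty Zariski
open set. The generic leading exponents form an up-closed set, which by Dickson's lemma has
finitely many minimal elements; once these are leading exponents of `g(I)`, so are all generic
leading exponents, and there are no others, as the number of leading exponents in each degree does
not depend on `g`. -/
theorem isZariskiOpen_genericLocus_and_nonempty [Infinite k] (I : Ideal (MvPolynomial (Fin n) k)) :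
    IsZariskiOpen (genericLocus I) ∧ (genericLocus I).Nonempty := by
  classical
  let W : (Fin n →₀ ℕ) → Set (GL (Fin n) k) := fun m =>
    maximizers I (upperFinset m) ∩ maximizers I (strictUpperFinset m)
  have hW : ∀ m, IsZariskiOpen (W m) ∧ (W m).Nonempty := fun m => by
    have h1 := isZariskiOpen_maximizers I (isFinalSegment_upperFinset m)
    have h2 := isZariskiOpen_maximizers I (isFinalSegment_strictUpperFinset m)
    exact ⟨h1.inter h2,
      h1.inter_nonempty h2 (maximizers_nonempty _ _) (maximizers_nonempty _ _)⟩
  -- the generic leading exponents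
  let E : Set (Fin n →₀ ℕ) := {m | ∃ g ∈ W m, m ∈ leadExps (transform g I)}
  have hE : ∀ m, ∀ g ∈ W m, m ∈ leadExps (transform g I) ↔ m ∈ E := fun m g hg =>
    ⟨fun h => ⟨g, hg, h⟩, fun ⟨h, hh, hm⟩ =>
      (mem_leadExps_iff_of_mem_maximizers hg.1 hg.2 hh.1 hh.2).2 hm⟩
  have hup : ∀ m ∈ E, ∀ u, m ≤ u → u ∈ E := fun m hm u hmu => by
    obtain ⟨g, hgm, hgu⟩ := (hW m).1.inter_nonempty (hW u).1 (hW m).2 (hW u).2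
    rw [← hE u g hgu]
    rw [← hE m g hgm] at hm
    exact mem_leadExps_of_le hm hmu
  have hfin : {m | Minimal (· ∈ E) m}.Finite :=
    WellQuasiOrderedLE.finite_of_isAntichain (setOfPred_minimal_antichain _)
  have key : (⋂ m ∈ hfin.toFinset, W m) = genericLocus I := by
    refine Set.Subset.antisymm (fun g hg d T hT => ?_) fun g hg => ?_
    · have hsub : E ⊆ leadExps (transform g I) := fun m hm => by
        obtain ⟨u, hum, hu⟩ := exists_minimal_le_of_wellFoundedLT (· ∈ E) m hm
        refine mem_leadExps_of_le ((hE u g ?_).2 hu.1) hum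
        exact Set.mem_iInter₂.1 hg u (hfin.mem_toFinset.2 hu)
      -- a comparison point where `N(g'(I))` is `E` in degree `d` and the count in `T` is maximal
      obtain ⟨g', hg', hg'T⟩ := (isZariskiOpen_biInter_and_nonempty (degreeFinset n d) W
        fun m _ => hW m).1.inter_nonempty (isZariskiOpen_maximizers I hT)
        (isZariskiOpen_biInter_and_nonempty (degreeFinset n d) W fun m _ => hW m).2
        (maximizers_nonempty _ _)
      have hle : leadFinset (transform g' I) (degreeFinset n d) ⊆
          leadFinset (transform g I) (degreeFinset n d) := fun m hm => by
        rw [mem_leadFinset] at hm ⊢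
        exact ⟨hm.1, hsub ((hE m g' (Set.mem_iInter₂.1 hg' m hm.1)).1 hm.2)⟩
      have hcard : (leadFinset (transform g I) (degreeFinset n d)).card ≤
          (leadFinset (transform g' I) (degreeFinset n d)).card := by
        have := card_leadFinset_degreeFinset_le (transform g I) (g' * g⁻¹) d
        rwa [transform_transform, inv_mul_cancel_right] at this
      have heq := Finset.eq_of_subset_of_card_le hle hcard
      have : leadFinset (transform g I) T = leadFinset (transform g' I) T := by
        ext m
        have := Finset.ext_iff.1 heq m
        simp only [mem_leadFinset, mem_degreeFinset] at this ⊢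
        exact and_congr_right fun hm => by simpa [hT.degree_eq m hm] using this.symm
      intro h
      rw [this]
      exact hg'T h
    · exact Set.mem_iInter₂.2 fun m _ => ⟨hg _ _ (isFinalSegment_upperFinset m),
        hg _ _ (isFinalSegment_strictUpperFinset m)⟩
  rw [← key]
  exact isZariskiOpen_biInter_and_nonempty _ _ fun m _ => hW m

theorem isGenericInitialIdeal_of_mem_genericLocus [Infinite k] {I : Ideal (MvPolynomial (Fin n) k)}
    (hI : IsHomogeneousIdeal I) {g : GL (Fin n) k} (hg : g ∈ genericLocus I) :
    IsGenericInitialIdeal I (initialIdeal (transform g I)) :=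
  ⟨genericLocus I, (isZariskiOpen_genericLocus_and_nonempty I).1, ⟨g, hg⟩, fun h hh => by
    rw [initialIdeal_eq_iff (isHomogeneousIdeal_transform h hI) (isHomogeneousIdeal_transform g hI)]
    exact leadExps_eq_of_mem_genericLocus hh hg⟩

theorem one_mem_genericLocus [Infinite k] {I : Ideal (MvPolynomial (Fin n) k)}
    (hI : IsHomogeneousIdeal I) (hgen : InGenericCoordinates I) : 1 ∈ genericLocus I := by
  obtain ⟨g, hg⟩ := (isZariskiOpen_genericLocus_and_nonempty I).2
  refine mem_genericLocus_of_leadExps_eq hg ?_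
  rw [transform_one, ← initialIdeal_eq_iff hI (isHomogeneousIdeal_transform g hI),
    ← (isGenericInitialIdeal_of_mem_genericLocus hI hg).gin_eq]
  exact hgen

/-! ### The exchange property of the generic initial ideal in characteristic zero -/

/-- The elementary change of coordinates `X j ↦ X j + t * X i`, where `t` is an indeterminate
adjoined to the field of coefficients. -/
noncomputable def shear (i j : Fin n) :
    MvPolynomial (Fin n) k →ₐ[k] MvPolynomial (Fin n) (Polynomial k) :=
  aeval fun l => X l + if l = j then C Polynomial.X * X i else 0

/-- The elementary change of coordinates `X j ↦ X j + t * X i` for a scalar `t`. -/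
noncomputable def elementary {i j : Fin n} (hij : i ≠ j) (t : k) : GL (Fin n) k :=
  Matrix.GeneralLinearGroup.mkOfDetNeZero (Matrix.transvection i j t)
    (by rw [Matrix.det_transvection_of_ne _ _ hij]; exact one_ne_zero)

theorem map_shear {i j : Fin n} (hij : i ≠ j) (t : k) (f : MvPolynomial (Fin n) k) :
    map (Polynomial.evalRingHom t) (shear i j f) = coordChange (elementary hij t) f := by
  induction f using MvPolynomial.induction_on with
  | C a =>
    rw [← algebraMap_eq, AlgHom.commutes, AlgHom.commutes, MvPolynomial.algebraMap_apply, map_C,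
      algebraMap_eq, ← Polynomial.C_eq_algebraMap, Polynomial.coe_evalRingHom, Polynomial.eval_C]
  | add p q hp hq => rw [map_add, map_add, map_add, hp, hq]
  | mul_X p l hp =>
    rw [map_mul, map_mul, map_mul, hp, coordChange_X]
    congr 1
    have h : ∀ a, (elementary hij t : Matrix (Fin n) (Fin n) k) a l =
        (if a = l then 1 else 0) + if i = a ∧ j = l then t else 0 := fun a => by
      change Matrix.transvection i j t a l = _
      rw [Matrix.transvection, Matrix.add_apply, Matrix.one_apply, Matrix.single_apply]
    simp only [h, map_add, add_mul, Finset.sum_add_distrib, shear, aeval_X, map_X]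
    congr 1
    · simp [apply_ite C, ite_mul]
    · by_cases hl : l = j
      · simp [hl, apply_ite C, ite_mul]
      · simp [hl, Ne.symm hl]

/-- The expansion of a sheared polynomial modulo `t ^ 2`. -/
theorem shear_expansion (i j : Fin n) (f : MvPolynomial (Fin n) k) :
    ∃ q, shear i j f = map Polynomial.C f +
      C Polynomial.X * (X i * map Polynomial.C (pderiv j f) + C Polynomial.X * q) := by
  induction f using MvPolynomial.induction_on with
  | C a =>
    refine ⟨0, ?_⟩
    rw [← algebraMap_eq, AlgHom.commutes]
    simp [MvPolynomial.algebraMap_apply]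
  | add p q hp hq =>
    obtain ⟨a, ha⟩ := hp
    obtain ⟨b, hb⟩ := hq
    refine ⟨a + b, ?_⟩
    simp only [map_add, ha, hb]
    ring
  | mul_X p l hp =>
    obtain ⟨a, ha⟩ := hp
    by_cases hl : l = j
    · subst hl
      refine ⟨a * X l + X i * (X i * map Polynomial.C (pderiv l p)) + C Polynomial.X * a * X i, ?_⟩
      rw [map_mul, ha, pderiv_mul, pderiv_X_self]
      simp only [shear, aeval_X, if_true, map_mul, map_add, map_X, mul_one]
      ring
    · refine ⟨a * X l, ?_⟩
      rw [map_mul, ha, pderiv_mul, pderiv_X_of_ne hl]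
      simp only [shear, aeval_X, if_neg hl, map_mul, map_X, mul_zero, add_zero]
      ring

theorem coeff_X_mul_pderiv (i j : Fin n) (f : MvPolynomial (Fin n) k) (m : Fin n →₀ ℕ) :
    coeff (m + Finsupp.single i 1) (X i * pderiv j f) =
      coeff (m + Finsupp.single j 1) f * (m j + 1) := by
  rw [mul_comm, coeff_mul_X, coeff_pderiv]

theorem coeff_X_mul_pderiv_eq_zero {i j : Fin n} {f : MvPolynomial (Fin n) k} {m u : Fin n →₀ ℕ}
    (hf : ∀ v, toLex (m + Finsupp.single j 1) < toLex v → coeff v f = 0)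
    (hu : toLex (m + Finsupp.single i 1) < toLex u) : coeff u (X i * pderiv j f) = 0 := by
  by_cases hi : i ∈ u.support
  · obtain ⟨v, rfl⟩ : ∃ v, u = v + Finsupp.single i 1 := by
      refine ⟨u - Finsupp.single i 1, (tsub_add_cancel_of_le ?_).symm⟩
      rw [Finsupp.single_le_iff]
      exact Nat.one_le_iff_ne_zero.2 (Finsupp.mem_support_iff.1 hi)
    rw [coeff_X_mul_pderiv, hf, zero_mul]
    rw [toLex_add, toLex_add] at hu ⊢
    exact add_lt_add_left (lt_of_add_lt_add_right hu) _
  · rw [coeff_X_mul', if_neg hi]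

/-- In generic coordinates the leading exponents are stable under replacing a variable by a larger
one. Suppose that `w = m + e_i` is not a leading exponent, while `m + e_j` is the leading exponent
of `f ∈ I`. Under `X j ↦ X j + t * X i` the part of `f` with exponents at least `w` becomes
`t` times `c * X ^ w` plus multiples of `t ^ 2`, with `c ≠ 0` in characteristic zero. Together with
the elements of `I` leading at the leading exponents above `w`, this produces for some `t` one
leading exponent too many. -/
theorem exchange_mem_leadExps [CharZero k] {I : Ideal (MvPolynomial (Fin n) k)}
    (hgen : (1 : GL (Fin n) k) ∈ genericLocus I) {i j : Fin n} (hij : i < j) {m : Fin n →₀ ℕ}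
    (hm : m + Finsupp.single j 1 ∈ leadExps I) : m + Finsupp.single i 1 ∈ leadExps I := by
  classical
  by_contra hw
  set w := m + Finsupp.single i 1 with hwdef
  have hmw : toLex (m + Finsupp.single j 1) < toLex w := by
    rw [hwdef, toLex_add, toLex_add]
    exact add_lt_add_right (Finsupp.Lex.single_lt_iff.2 hij) _
  have hT := isFinalSegment_upperFinset w
  set T := upperFinset w
  have hwT : w ∈ T := mem_upperFinset.2 ⟨rfl, le_rfl⟩
  have hdeg : (m + Finsupp.single j 1).degree = w.degree := by simp [hwdef]
  obtain ⟨f₀, hf₀, hd₀, hc₀, hl₀⟩ := hm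
  rw [hdeg] at hd₀
  obtain ⟨f, hf, hd, hlead, hlt⟩ := exists_family_leadFinset I hT
  set S := insert w (leadFinset I T) with hS
  have hwS : w ∉ leadFinset I T := fun h => hw (mem_leadFinset.1 h).2
  have hST : S ⊆ T := Finset.insert_subset hwT (leadFinset_subset _ _)
  let F : S → MvPolynomial (Fin n) k := fun s =>
    if hs : s.1 = w then f₀ else f ⟨s.1, (Finset.mem_insert.1 s.2).resolve_left hs⟩
  have hFw : ∀ s : S, s.1 = w → F s = f₀ := fun s hs => dif_pos hs
  have hFs : ∀ s : S, (hs : s.1 ≠ w) →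
      F s = f ⟨s.1, (Finset.mem_insert.1 s.2).resolve_left hs⟩ := fun s hs => dif_neg hs
  have hFI : ∀ s, F s ∈ I := fun s => by
    by_cases hs : s.1 = w
    · rwa [hFw s hs]
    · rw [hFs s hs]
      exact hf _
  have hFd : ∀ s, (F s).IsHomogeneous w.degree := fun s => by
    by_cases hs : s.1 = w
    · rwa [hFw s hs]
    · rw [hFs s hs]
      exact hd _
  obtain ⟨q, hq⟩ := shear_expansion i j f₀
  -- the coefficient matrix of the sheared `F s`, with the factor `t` taken out of the row of `f₀`;
  -- at `t = 0` it is triangular with nonzero diagonal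
  let A : Matrix S S (Polynomial k) := Matrix.of fun s u =>
    if s.1 = w then coeff u.1 (X i * map Polynomial.C (pderiv j f₀) + C Polynomial.X * q)
    else coeff u.1 (shear i j (F s))
  have hA₁ : ∀ s u : S, s.1 = w → A s u =
      coeff u.1 (X i * map Polynomial.C (pderiv j f₀) + C Polynomial.X * q) :=
    fun _ _ hs => if_pos hs
  have hA₂ : ∀ s u : S, s.1 ≠ w → A s u = coeff u.1 (shear i j (F s)) := fun _ _ hs => if_neg hs
  have hA : A.det ≠ 0 := fun h => by
    have h0 : (A.map (Polynomial.evalRingHom 0)).det = 0 := by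
      rw [← RingHom.mapMatrix_apply, ← RingHom.map_det, h, map_zero]
    have hAw : ∀ s u : S, s.1 = w →
        A.map (Polynomial.evalRingHom 0) s u = coeff u.1 (X i * pderiv j f₀) := fun s u hs => by
      have : (X i * map Polynomial.C (pderiv j f₀) : MvPolynomial (Fin n) (Polynomial k)) =
          map Polynomial.C (X i * pderiv j f₀) := by rw [map_mul, map_X]
      rw [Matrix.map_apply, hA₁ s u hs, this, coeff_add, coeff_map, coeff_C_mul]
      simp
    have hAs : ∀ s u : S, s.1 ≠ w →
        A.map (Polynomial.evalRingHom 0) s u = coeff u.1 (F s) := fun s u hs => by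
      obtain ⟨p, hp⟩ := shear_expansion i j (F s)
      rw [Matrix.map_apply, hA₂ s u hs, hp, coeff_add, coeff_map, coeff_C_mul]
      simp
    refine det_ne_zero_of_triangular _ (fun s u hsu => ?_) (fun s => ?_) h0
    · by_cases hs : s.1 = w
      · rw [hAw s u hs]
        rw [hs] at hsu
        exact coeff_X_mul_pderiv_eq_zero hl₀ hsu
      · rw [hAs s u hs, hFs s hs]
        exact hlt _ _ hsu
    · by_cases hs : s.1 = w
      · rw [hAw s s hs, hs, hwdef, coeff_X_mul_pderiv]
        exact mul_ne_zero hc₀ (Nat.cast_add_one_ne_zero _)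
      · rw [hAs s s hs, hFs s hs]
        exact hlead _
  obtain ⟨t, ht⟩ : ∃ t, (Polynomial.X * A.det).eval t ≠ 0 := by
    by_contra! h
    exact mul_ne_zero Polynomial.X_ne_zero hA
      (Polynomial.funext fun t => by rw [h t, Polynomial.eval_zero])
  rw [Polynomial.eval_mul, Polynomial.eval_X] at ht
  have hmat : (Matrix.of fun s u : S => coeff u.1 (coordChange (elementary hij.ne t) (F s))) =
      Matrix.of fun s u : S => (if s.1 = w then t else 1) *
        A.map (Polynomial.evalRingHom t) s u := by
    ext s u
    rw [Matrix.of_apply, Matrix.of_apply, ← map_shear, coeff_map, Matrix.map_apply]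
    by_cases hs : s.1 = w
    · have hu : coeff u.1 f₀ = 0 :=
        hl₀ _ (hmw.trans_le (mem_upperFinset.1 (hST u.2)).2)
      rw [if_pos hs, hFw s hs, hq, hA₁ s u hs, coeff_add, coeff_map, hu, map_zero,
        zero_add, coeff_C_mul, map_mul,
        Polynomial.coe_evalRingHom, Polynomial.eval_X]
    · rw [if_neg hs, one_mul, hA₂ s u hs]
  have hdet : (Matrix.of fun s u : S =>
      coeff u.1 (coordChange (elementary hij.ne t) (F s))).det ≠ 0 := by
    rw [hmat, Matrix.det_mul_column, ← RingHom.mapMatrix_apply, ← RingHom.map_det]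
    refine mul_ne_zero (Finset.prod_ne_zero_iff.2 fun s _ => ?_) (right_ne_zero_of_mul ht)
    split_ifs
    exacts [left_ne_zero_of_mul ht, one_ne_zero]
  have h1 := card_le_card_leadFinset_of_det_ne_zero hT hST _
    (fun s => coordChange_mem_transform (g := elementary hij.ne t) (hFI s))
    (fun s => isHomogeneous_coordChange _ (hFd s)) hdet
  have h2 := hgen _ T hT (elementary hij.ne t)
  rw [transform_one] at h2
  rw [hS, Finset.card_insert_of_notMem hwS] at h1
  omega

/-! ### Leading exponents of partial elimination ideals -/

theorem degree_cons (i : ℕ) (u : Fin r →₀ ℕ) : (Finsupp.cons i u).degree = i + u.degree := by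
  rw [Finsupp.degree_eq_sum, Finsupp.degree_eq_sum, Fin.sum_univ_succ]
  simp

theorem apply_zero_le_of_toLex_le {m v : Fin (r + 1) →₀ ℕ} (h : toLex m ≤ toLex v) :
    m 0 ≤ v 0 := by
  rcases h.eq_or_lt with h | h
  · rw [toLex.injective h]
  · obtain ⟨j, hj, hlt⟩ := Finsupp.Lex.lt_iff.1 h
    rcases eq_or_ne j 0 with rfl | hj0
    · exact hlt.le
    · exact (hj 0 (Fin.pos_of_ne_zero hj0)).le

theorem toLex_cons_lt_toLex_cons {i : ℕ} {u v : Fin r →₀ ℕ} :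
    toLex (Finsupp.cons i u) < toLex (Finsupp.cons i v) ↔ toLex u < toLex v := by
  rw [Finsupp.Lex.lt_iff, Finsupp.Lex.lt_iff]
  constructor
  · rintro ⟨j, hj, hlt⟩
    induction j using Fin.cases with
    | zero => simp at hlt
    | succ j => exact ⟨j, fun l hl => by simpa using hj l.succ (Fin.succ_lt_succ_iff.2 hl),
        by simpa using hlt⟩
  · rintro ⟨j, hj, hlt⟩
    refine ⟨j.succ, fun l hl => ?_, by simpa using hlt⟩
    induction l using Fin.cases with
    | zero => simp
    | succ l => simpa using hj l (Fin.succ_lt_succ_iff.1 hl)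

theorem coeff_bar (i : ℕ) (f : MvPolynomial (Fin (r + 1)) k) (u : Fin r →₀ ℕ) :
    coeff u (bar i f) = coeff (Finsupp.cons i u) f :=
  finSuccEquiv_coeff_coeff u f i

theorem mem_K {i : ℕ} {I : Ideal (MvPolynomial (Fin (r + 1)) k)} {q : MvPolynomial (Fin r) k} :
    q ∈ K i I ↔ ∃ f ∈ Ktilde i I, bar i f = q :=
  Iff.rfl

theorem mem_leadExps_K {I : Ideal (MvPolynomial (Fin (r + 1)) k)} (hI : IsHomogeneousIdeal I)
    {i : ℕ} {u : Fin r →₀ ℕ} : u ∈ leadExps (K i I) ↔ Finsupp.cons i u ∈ leadExps I := by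
  constructor
  · rintro ⟨q, hq, hd, hc, hl⟩
    obtain ⟨f, hf, rfl⟩ := mem_K.1 hq
    rw [mem_Ktilde_iff] at hf
    refine ⟨homogeneousComponent (Finsupp.cons i u).degree f,
      isHomogeneousIdeal_iff.1 hI f hf.1 _, homogeneousComponent_isHomogeneous _ _, ?_,
      fun v hv => ?_⟩
    · rwa [coeff_homogeneousComponent, if_pos rfl, ← coeff_bar]
    · rw [coeff_homogeneousComponent]
      split_ifs with h
      · have h0 : i ≤ v 0 := by simpa using apply_zero_le_of_toLex_le hv.le
        rcases h0.eq_or_lt with h0 | h0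
        · rw [← Finsupp.cons_tail v, ← h0] at hv ⊢
          rw [← coeff_bar]
          exact hl _ (toLex_cons_lt_toLex_cons.1 hv)
        · by_contra hne
          exact absurd (degreeOf_le_iff.1 hf.2 v (mem_support_iff.2 hne)) (not_le.2 h0)
      · rfl
  · rintro ⟨f, hf, hd, hc, hl⟩
    refine ⟨bar i f, ⟨f, mem_Ktilde_iff.2 ⟨hf, degreeOf_le_iff.2 fun v hv => ?_⟩, rfl⟩, ?_,
      by rwa [coeff_bar], fun v hv => ?_⟩
    · by_contra! h
      refine mem_support_iff.1 hv (hl v (not_le.1 fun hle => absurd h (not_lt.2 ?_)))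
      simpa using apply_zero_le_of_toLex_le hle
    · rw [degree_cons] at hd
      exact hd.finSuccEquiv_coeff_isHomogeneous i _ rfl
    · rw [coeff_bar]
      exact hl _ (toLex_cons_lt_toLex_cons.2 hv)

theorem isHomogeneousIdeal_K {I : Ideal (MvPolynomial (Fin (r + 1)) k)}
    (hI : IsHomogeneousIdeal I) (i : ℕ) : IsHomogeneousIdeal (K i I) := by
  rw [isHomogeneousIdeal_iff]
  intro q hq d
  obtain ⟨f, hf, rfl⟩ := mem_K.1 hq
  rw [mem_Ktilde_iff] at hf
  refine ⟨homogeneousComponent (i + d) f, mem_Ktilde_iff.2 ⟨isHomogeneousIdeal_iff.1 hI f hf.1 _,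
    degreeOf_le_iff.2 fun v hv => degreeOf_le_iff.1 hf.2 v ?_⟩, ?_⟩
  · rw [support_homogeneousComponent] at hv
    exact Finset.filter_subset _ _ hv
  · ext u
    rw [coeff_bar, coeff_homogeneousComponent, coeff_homogeneousComponent, coeff_bar, degree_cons]
    simp

/-! ### Coordinate changes fixing the first variable -/

/-- The block matrix with blocks `1` and `A`. -/
def extendMatrix {R : Type*} [CommRing R] (A : Matrix (Fin r) (Fin r) R) :
    Matrix (Fin (r + 1)) (Fin (r + 1)) R :=
  Matrix.of fun i j => Fin.cases (Fin.cases 1 (fun _ => 0) j) (fun i' => Fin.cases 0 (A i') j) i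

section
variable {R : Type*} [CommRing R] (A : Matrix (Fin r) (Fin r) R) (i j : Fin r)

@[simp] theorem extendMatrix_zero_zero : extendMatrix A 0 0 = 1 := rfl
@[simp] theorem extendMatrix_zero_succ : extendMatrix A 0 j.succ = 0 := rfl
@[simp] theorem extendMatrix_succ_zero : extendMatrix A i.succ 0 = 0 := rfl
@[simp] theorem extendMatrix_succ_succ : extendMatrix A i.succ j.succ = A i j := rfl

end

/-- The embedding of `GL_r` into `GL_{r+1}` as the linear changes of `X 1, …, X r`, fixing `X 0`. -/
def extendGL : GL (Fin r) k →* GL (Fin (r + 1)) k :=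
  Units.map
    { toFun := extendMatrix
      map_one' := by
        ext i j
        refine Fin.cases (Fin.cases ?_ (fun j => ?_) j)
          (fun i => Fin.cases ?_ (fun j => ?_) j) i <;>
          simp [Matrix.one_apply, Fin.succ_ne_zero, (Fin.succ_ne_zero _).symm]
      map_mul' := fun A B => by
        ext i j
        refine Fin.cases (Fin.cases ?_ (fun j => ?_) j)
          (fun i => Fin.cases ?_ (fun j => ?_) j) i <;>
          simp [Matrix.mul_apply, Fin.sum_univ_succ] }

theorem coe_extendGL (g : GL (Fin r) k) :
    (extendGL g : Matrix (Fin (r + 1)) (Fin (r + 1)) k) = extendMatrix (g : Matrix _ _ k) := rfl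

theorem finSuccEquiv_coordChange_extendGL (g : GL (Fin r) k) (f : MvPolynomial (Fin (r + 1)) k) :
    finSuccEquiv k r (coordChange (extendGL g) f) =
      (finSuccEquiv k r f).map (coordChange g : MvPolynomial (Fin r) k →+* _) := by
  induction f using MvPolynomial.induction_on with
  | C a =>
    rw [← algebraMap_eq, AlgHom.commutes, AlgEquiv.commutes]
    simp [Polynomial.algebraMap_apply, algHom_C]
  | add p q hp hq => rw [map_add, map_add, map_add, hp, hq, Polynomial.map_add]
  | mul_X p j hp =>
    rw [map_mul, map_mul, map_mul, hp, Polynomial.map_mul, coordChange_X]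
    congr 1
    have hC : ∀ a : k, finSuccEquiv k r (C a) = Polynomial.C (C a) := fun a => by
      simp [finSuccEquiv_apply]
    induction j using Fin.cases with
    | zero =>
      rw [Fin.sum_univ_succ]
      simp [coe_extendGL, finSuccEquiv_X_zero]
    | succ j =>
      rw [Fin.sum_univ_succ]
      simp [coe_extendGL, finSuccEquiv_X_succ, coordChange_X, hC]

theorem bar_coordChange_extendGL (i : ℕ) (g : GL (Fin r) k) (f : MvPolynomial (Fin (r + 1)) k) :
    bar i (coordChange (extendGL g) f) = coordChange g (bar i f) := by
  rw [bar, finSuccEquiv_coordChange_extendGL, Polynomial.coeff_map]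
  rfl

theorem coordChange_extendGL_mem_Ktilde {i : ℕ} {I : Ideal (MvPolynomial (Fin (r + 1)) k)}
    {f : MvPolynomial (Fin (r + 1)) k} (hf : f ∈ Ktilde i I) (g : GL (Fin r) k) :
    coordChange (extendGL g) f ∈ Ktilde i (transform (extendGL g) I) := by
  rw [mem_Ktilde_iff] at hf ⊢
  refine ⟨coordChange_mem_transform hf.1, le_trans ?_ hf.2⟩
  rw [← natDegree_finSuccEquiv, ← natDegree_finSuccEquiv, finSuccEquiv_coordChange_extendGL]
  exact Polynomial.natDegree_map_le

theorem K_transform_extendGL (i : ℕ) (g : GL (Fin r) k)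
    (I : Ideal (MvPolynomial (Fin (r + 1)) k)) :
    K i (transform (extendGL g) I) = transform g (K i I) := by
  ext q
  rw [mem_transform]
  constructor
  · intro hq
    obtain ⟨f, hf, rfl⟩ := mem_K.1 hq
    have := coordChange_extendGL_mem_Ktilde hf g⁻¹
    rw [transform_transform, ← map_mul, inv_mul_cancel, map_one, transform_one] at this
    exact mem_K.2 ⟨_, this, bar_coordChange_extendGL _ _ _⟩
  · intro hq
    obtain ⟨f, hf, hfq⟩ := mem_K.1 hq
    refine mem_K.2 ⟨_, coordChange_extendGL_mem_Ktilde hf g, ?_⟩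
    rw [bar_coordChange_extendGL, hfq, ← coordChange_mul, mul_inv_cancel, coordChange_one]

theorem IsZariskiOpen.preimage_extendGL {U : Set (GL (Fin (r + 1)) k)} (hU : IsZariskiOpen U) :
    IsZariskiOpen {g : GL (Fin r) k | extendGL g ∈ U} := by
  have key : ∀ (g : GL (Fin r) k) p, evalEntries g (aeval (fun ij : Fin (r + 1) × Fin (r + 1) =>
      extendMatrix (Matrix.of fun i j => X (R := k) (i, j)) ij.1 ij.2) p) =
      evalEntries (extendGL g) p := fun g p => by
    induction p using MvPolynomial.induction_on with
    | C a => simp [evalEntries]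
    | add p q hp hq => rw [map_add, map_add, map_add, hp, hq]
    | mul_X p ij hp =>
      rw [map_mul, map_mul, map_mul, hp, aeval_X]
      congr 1
      obtain ⟨i, j⟩ := ij
      refine Fin.cases (Fin.cases ?_ (fun j => ?_) j) (fun i => Fin.cases ?_ (fun j => ?_) j) i <;>
        simp [evalEntries, coe_extendGL]
  rw [isZariskiOpen_iff] at hU ⊢
  intro g hg
  obtain ⟨p, hp, hpU⟩ := hU _ hg
  exact ⟨_, (key g p).trans_ne hp, fun h hh => hpU _ ((key h p).symm.trans_ne hh)⟩

/-- Partial elimination ideals of an ideal in generic coordinates are in generic coordinates: the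
generic locus of `I` restricts to a Zariski open subset of `GL_r` containing the identity, and there
the initial ideal of `K_i` is constant. -/
theorem gin_K [Infinite k] {I : Ideal (MvPolynomial (Fin (r + 1)) k)} (hI : IsHomogeneousIdeal I)
    (hgen : (1 : GL (Fin (r + 1)) k) ∈ genericLocus I) (i : ℕ) :
    gin (K i I) = initialIdeal (K i I) := by
  refine IsGenericInitialIdeal.gin_eq ⟨{g | extendGL g ∈ genericLocus I},
    (isZariskiOpen_genericLocus_and_nonempty I).1.preimage_extendGL, ⟨1, ?_⟩, fun g hg => ?_⟩
  · rwa [Set.mem_ofPred_eq, map_one]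
  · have hKI := isHomogeneousIdeal_K hI i
    rw [initialIdeal_eq_iff (isHomogeneousIdeal_transform g hKI) hKI]
    ext u
    rw [← K_transform_extendGL, mem_leadExps_K (isHomogeneousIdeal_transform _ hI),
      mem_leadExps_K hI, leadExps_eq_of_mem_genericLocus hg hgen, transform_one]

/-! ### Minimal generators -/

theorem mem_minGenExponents_gin {n : ℕ} {I : Ideal (MvPolynomial (Fin n) k)}
    (hI : IsHomogeneousIdeal I) (hgin : gin I = initialIdeal I) {m : Fin n →₀ ℕ} :
    m ∈ minGenExponents (gin I) ↔ Minimal (· ∈ leadExps I) m := by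
  simp only [hgin, minGenExponents, monomial_mem_initialIdeal hI]
  rfl

theorem cons_le_cons {i j : ℕ} {u v : Fin r →₀ ℕ} (hij : i ≤ j) (huv : u ≤ v) :
    Finsupp.cons i u ≤ Finsupp.cons j v := fun l => by
  induction l using Fin.cases with
  | zero => simpa using hij
  | succ l => simpa using huv l

theorem cons_add_single_succ (i : ℕ) (u : Fin r →₀ ℕ) (j : Fin r) :
    Finsupp.cons i (u + Finsupp.single j 1) =
      Finsupp.cons i u + Finsupp.single j.succ 1 := by
  ext l
  induction l using Fin.cases with
  | zero => simp
  | succ l => simp [Finsupp.single_apply]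

theorem cons_add_single_zero (i : ℕ) (u : Fin r →₀ ℕ) :
    Finsupp.cons i u + Finsupp.single 0 1 = Finsupp.cons (i + 1) u := by
  ext l
  induction l using Fin.cases with
  | zero => simp
  | succ l => simp

theorem exists_eq_add_single {u : Fin r →₀ ℕ} (hu : u ≠ 0) :
    ∃ v j, u = v + Finsupp.single j 1 := by
  obtain ⟨j, hj⟩ := Finsupp.ne_iff.1 hu
  refine ⟨u - Finsupp.single j 1, j, (tsub_add_cancel_of_le ?_).symm⟩
  rw [Finsupp.single_le_iff]
  exact Nat.one_le_iff_ne_zero.2 hj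

theorem cons_succ_mem_leadExps [CharZero k] {I : Ideal (MvPolynomial (Fin (r + 1)) k)}
    (hgen : (1 : GL (Fin (r + 1)) k) ∈ genericLocus I) {i : ℕ} {u : Fin r →₀ ℕ} {j : Fin r}
    (h : Finsupp.cons i (u + Finsupp.single j 1) ∈ leadExps I) :
    Finsupp.cons (i + 1) u ∈ leadExps I := by
  rw [cons_add_single_succ] at h
  rw [← cons_add_single_zero]
  exact exchange_mem_leadExps hgen (Fin.succ_pos j) h

/-- All variables of a leading monomial can be replaced by `X 0`. -/
theorem cons_zero_mem_leadExps [CharZero k] {I : Ideal (MvPolynomial (Fin (r + 1)) k)}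
    (hgen : (1 : GL (Fin (r + 1)) k) ∈ genericLocus I) {d : ℕ} :
    ∀ {i : ℕ} {u : Fin r →₀ ℕ}, u.degree = d →
    Finsupp.cons i u ∈ leadExps I → Finsupp.cons (i + d) 0 ∈ leadExps I := by
  induction d with
  | zero =>
    intro i u hu h
    rwa [(Finsupp.degree_eq_zero_iff u).1 hu] at h
  | succ d ih =>
    intro i u hu h
    obtain ⟨v, j, rfl⟩ := exists_eq_add_single (u := u) (by rintro rfl; simp at hu)
    have := ih (i := i + 1) (u := v) (by simpa using hu) (cons_succ_mem_leadExps hgen h)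
    rwa [add_right_comm, add_assoc] at this

/-- A minimal element of the `i`-th slice gives a minimal leading exponent: if `u` is minimal with
`cons i u` leading, then `cons (i - 1) u` is not leading, as otherwise the exchange property would
turn a variable of `u` into `X 0` and contradict the minimality of `u`. If `u = 0`, this exponent is
not leading because its degree is less than `β`. -/
theorem minimal_mem_leadExps_cons_iff [CharZero k] {I : Ideal (MvPolynomial (Fin (r + 1)) k)}
    (hgen : (1 : GL (Fin (r + 1)) k) ∈ genericLocus I)
    {β : ℕ} (hβ : ∀ m ∈ leadExps I, β ≤ m.degree)
    (hβ' : ∃ m ∈ leadExps I, m.degree = β) {i : ℕ} {u : Fin r →₀ ℕ} :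
    Minimal (· ∈ leadExps I) (Finsupp.cons i u) ↔
      i ≤ β ∧ Minimal (fun v => Finsupp.cons i v ∈ leadExps I) u := by
  constructor
  · intro h
    refine ⟨?_, h.1, fun v hv hvu l => ?_⟩
    · obtain ⟨m, hm, hmβ⟩ := hβ'
      rw [← Finsupp.cons_tail m] at hm hmβ
      have h0 := cons_zero_mem_leadExps hgen rfl hm
      rw [← degree_cons, hmβ] at h0
      by_contra! hlt
      have := h.2 h0 (cons_le_cons hlt.le zero_le) 0
      simp only [Finsupp.cons_zero] at this
      omega
    · simpa using h.2 hv (cons_le_cons le_rfl hvu) l.succ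
  · rintro ⟨hi, h⟩
    refine ⟨h.1, fun v hv hvu => ?_⟩
    have hv0 : v 0 ≤ i := by simpa using hvu 0
    have hvt : v.tail ≤ u := fun l => hvu l.succ
    rw [← Finsupp.cons_tail v] at hv ⊢
    rcases hv0.eq_or_lt with h0 | h0
    · rw [h0] at hv ⊢
      exact cons_le_cons le_rfl (h.2 hv hvt)
    · exfalso
      obtain ⟨i, rfl⟩ := Nat.exists_eq_succ_of_ne_zero (Nat.ne_zero_of_lt h0)
      have h1 : Finsupp.cons i u ∈ leadExps I :=
        mem_leadExps_of_le hv (cons_le_cons (Nat.lt_succ_iff.1 h0) hvt)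
      by_cases hu : u = 0
      · have := hβ _ h1
        rw [degree_cons, hu, map_zero] at this
        omega
      · obtain ⟨w, j, rfl⟩ := exists_eq_add_single hu
        have := h.2 (cons_succ_mem_leadExps hgen h1) le_self_add j
        simp at this

end PartialElim

theorem mainTheorem8 {k : Type*} [Field k] [IsAlgClosed k] [CharZero k] (r : ℕ)
    (I : Ideal (MvPolynomial (Fin (r + 1)) k))
    (hI : PartialElim.IsHomogeneousIdeal I)
    (hgen : PartialElim.InGenericCoordinates I)
    (β : ℕ) (hβ : IsLeast {j : ℕ | ∃ f ∈ I, f.IsHomogeneous j ∧ f ≠ 0} β) :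
    PartialElim.M I =
      (Finset.range (β + 1)).sup fun i => PartialElim.M (PartialElim.K i I) + (i : WithBot ℕ) := by
  open PartialElim in
  have hone := one_mem_genericLocus hI hgen
  have hβ₁ : ∀ m ∈ leadExps I, β ≤ m.degree := by
    rintro m ⟨f, hf, hd, hc, -⟩
    exact hβ.2 ⟨f, hf, hd, by rintro rfl; simp at hc⟩
  have hβ₂ : ∃ m ∈ leadExps I, m.degree = β := by
    obtain ⟨f, hf, hd, hf0⟩ := hβ.1
    refine ⟨_, (leadExps_eq_image_degree hI).ge ⟨f, ⟨hf, hf0⟩, rfl⟩, ?_⟩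
    by_contra h
    exact MvPolynomial.mem_support_iff.1
      ((MonomialOrder.degLex (σ := Fin (r + 1))).degree_mem_support hf0) (hd.coeff_eq_zero h)
  have hmin : ∀ i u, Finsupp.cons i u ∈ minGenExponents (gin I) ↔
      i ≤ β ∧ u ∈ minGenExponents (gin (K i I)) := fun i u => by
    rw [mem_minGenExponents_gin hI hgen.symm,
      mem_minGenExponents_gin (isHomogeneousIdeal_K hI i) (gin_K hI hone i),
      minimal_mem_leadExps_cons_iff hone hβ₁ hβ₂]
    simp only [mem_leadExps_K hI]
  refine le_antisymm (Finset.sup_le fun m hm => ?_) (Finset.sup_le fun i hi => ?_)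
  · rw [Set.Finite.mem_toFinset, ← Finsupp.cons_tail m, hmin] at hm
    refine le_trans ?_ (Finset.le_sup (Finset.mem_range.2 (Nat.lt_succ_iff.2 hm.1)))
    have hle : ((m.tail.degree : ℕ) : WithBot ℕ) ≤ M (K (m 0) I) :=
      Finset.le_sup (f := fun u : Fin r →₀ ℕ => ((u.degree : ℕ) : WithBot ℕ))
        ((minGenExponents_finite _).mem_toFinset.2 hm.2)
    conv_lhs => rw [← Finsupp.cons_tail m, degree_cons, add_comm, Nat.cast_add]
    gcongr
  · rw [Finset.mem_range, Nat.lt_succ_iff] at hi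
    rcases (minGenExponents_finite (gin (K i I))).toFinset.eq_empty_or_nonempty with h | h
    · rw [M, h, Finset.sup_empty, WithBot.bot_add]
      exact bot_le
    · obtain ⟨u, hu, hMu⟩ := Finset.exists_mem_eq_sup _ h fun u : Fin r →₀ ℕ =>
        ((u.degree : ℕ) : WithBot ℕ)
      rw [M, hMu, ← Nat.cast_add, add_comm, ← degree_cons]
      rw [Set.Finite.mem_toFinset] at hu
      exact Finset.le_sup (f := fun v : Fin (r + 1) →₀ ℕ => ((v.degree : ℕ) : WithBot ℕ))
        ((minGenExponents_finite _).mem_toFinset.2 ((hmin i u).2 ⟨hi, hu⟩))
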